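/- Let $d\ge 1$ and let $\mathbf E\subset\mathbb R^d$ be a compact convex set with non-empty interior, equipped with its Borel $\sigma$-algebra. Let $\mathbf M$ be the set of all measures $m$ on $\mathbf E$ with $m(A)\in\{0,1,2,\dots\}$ for every Borel set $A\subseteq\mathbf E$, equipped with the $\sigma$-algebra generated by the maps $m\mapsto m(A)$. Let $\mathbf C$ be the family of all closed convex sets $C\subseteq\mathbf E$ with Lebesgue measure $|C|>0$. For $C\in\mathbf C$ and $\lambda>0$, a Poisson point process of intensity $\lambda$ on $C$ is a random element $\mathcal N$ of $\mathbf M$ such that $\mathcal N(A)$ has the Poisson distribution with parameter $\lambda|A\cap C|$ for every Borel set $A\subseteq\mathbf E$, and such that $\mathcal N(A_1),\dots,\mathcal N(A_n)$ are independent for all mutually disjoint Borel sets $A_1,\dots,A_n\subseteq\mathbf E$. Write $\mathbb E_C$ for the expectation when $\mathcal N$ is such a process. Then $$\liminf_{\lambda\to\infty}\ \lambda^{(d+3)/(d+1)}\ \inf_{\hat\theta_\lambda}\ \sup_{C\in\mathbf C}\ \mathbb E_C\big[(|C|-\hat\theta_\lambda(\mathcal N))^2\big]>0,$$ where, for each $\lambda$,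 the infimum extends over all estimators, i.e. all measurable functions $\hat\theta_\lambda:\mathbf M\to\mathbb R$. -/

import Mathlib

open MeasureTheory ProbabilityTheory
open scoped ENNReal NNReal

noncomputable section

namespace ConvexSupport

/-- Point measures on the state space `E`: measures on the Borel σ-algebra of `E` all of whose
values are natural numbers. As a subtype of `Measure E` the space of point measures carries the
σ-algebra generated by the evaluations `m ↦ m A`, `A` a measurable subset of `E`. -/
def PointMeasure {d : ℕ} (E : Set (EuclideanSpace ℝ (Fin d))) : Type :=
  {m : Measure E // ∀ A : Set E, MeasurableSet A → ∃ n : ℕ, m A = n}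

instance {d : ℕ} (E : Set (EuclideanSpace ℝ (Fin d))) : MeasurableSpace (PointMeasure E) :=
  inferInstanceAs
    (MeasurableSpace {m : Measure E // ∀ A : Set E, MeasurableSet A → ∃ n : ℕ, m A = n})

/-- The parameter class: closed convex subsets of `E` of positive Lebesgue measure. -/
def ConvexClass {d : ℕ} (E : Set (EuclideanSpace ℝ (Fin d))) :
    Set (Set (EuclideanSpace ℝ (Fin d))) :=
  {C | C ⊆ E ∧ Convex ℝ C ∧ IsClosed C ∧ 0 < volume C}

/-- `N` is, under the probability measure `P`, a Poisson point process with state space `E` of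
intensity `lam` on the set `C`. -/
structure IsPoissonPointProcess {d : ℕ} {E : Set (EuclideanSpace ℝ (Fin d))}
    {Ω : Type*} [MeasurableSpace Ω] (N : Ω → PointMeasure E) (P : Measure Ω)
    (lam : ℝ≥0) (C : Set (EuclideanSpace ℝ (Fin d))) : Prop where
  isProbabilityMeasure : IsProbabilityMeasure P
  measurable : Measurable N
  /-- `N(A)` is Poisson distributed with parameter `lam * |A ∩ C|`. -/
  count_law : ∀ A : Set E, MeasurableSet A →
    P.map (fun ω => (N ω).1 A) =
      (poissonMeasure (lam * (volume (Subtype.val '' A ∩ C)).toNNReal)).map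
        (fun k : ℕ => (k : ℝ≥0∞))
  /-- The counts of mutually disjoint sets are independent. -/
  indep : ∀ (n : ℕ) (A : Fin n → Set E), (∀ i, MeasurableSet (A i)) →
    Pairwise (fun i j => Disjoint (A i) (A j)) →
    iIndepFun (fun i ω => (N ω).1 (A i)) P

/-- The maximal mean squared error over the parameter class of an estimator `θ` of the volume,
`sup_C 𝔼_C[(|C| - θ(N))²]`, with values in `[0, ∞]`. For each `C`, the expectation is with respect
to the law `Q` of a Poisson point process of intensity `lam` on `C`. -/
def maxRisk {d : ℕ} (E : Set (EuclideanSpace ℝ (Fin d))) (lam : ℝ≥0)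
    (θ : PointMeasure E → ℝ) : ℝ≥0∞ :=
  ⨆ C ∈ ConvexClass E, ⨆ Q : Measure (PointMeasure E),
    ⨆ _ : IsPoissonPointProcess (id : PointMeasure E → PointMeasure E) Q lam C,
      ∫⁻ m, ENNReal.ofReal ((volume.real C - θ m) ^ 2) ∂Q

/-- The minimax squared risk for estimating `|C|` in the Poisson point process model of intensity
`lam`. The estimators are the measurable real functions of the observed point measure. -/
def minimaxRisk {d : ℕ} (E : Set (EuclideanSpace ℝ (Fin d))) (lam : ℝ≥0) : ℝ≥0∞ :=
  ⨅ θ : PointMeasure E → ℝ, ⨅ _ : Measurable θ, maxRisk E lam θ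

end ConvexSupport

end

/-! Lower bound for the minimax risk of volume estimation of a convex support. The Poisson point
process is constructed from its characteristic functionals; the lower bound averages the risk over
a hypercube of convex sets obtained by cutting disjoint caps from a paraboloid.
-/

noncomputable section

namespace ConvexSupport

/-! ### Poisson point processes with finite intensity measure: construction, restriction, void
probabilities. -/

section Poisson

variable {d : ℕ} {E : Set (EuclideanSpace ℝ (Fin d))}

/-! The maximal risk is bounded below by an average over a hypercube of convex sets. Write d = n + 1
and place a paraboloid with apex in the interior of `E`. Half-spaces cut from it, at grid abscissae
2δ apart, of order δ⁻ⁿ disjoint caps with volume of order δ^(n+2). Deleting any subfamily of caps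
from `E ∩ paraboloid p` intersects it with half-spaces, so a convex set remains.

All these models are coupled: restricting one Poisson process on `E` to each set gives a Poisson
process there. A cap without points leaves no trace of its deletion, so flipping the corresponding
bits does not change the data (`restr_prune_flipOn`). By orthogonality of signs every estimator then
pays at least a quarter of the squared volume of each empty cap (`le_sum_sq_sub_of_flip_invariant`,
`le_maxRisk_of_prune`).

For lam · δ^(n+2) = 1 a cap is empty with probability bounded below. The risk is thus at least of
order δ⁻ⁿ · δ^(2(n+2)) = δ^(n+4) = lam^(-(d+3)/(d+1)). -/

theorem measurable_count {A : Set E} (hA : MeasurableSet A) :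
    Measurable fun m : PointMeasure E => m.1 A :=
  (Measure.measurable_coe hA).comp measurable_subtype_coe

theorem PointMeasure.measurable_of_count {Ω : Type*} [MeasurableSpace Ω] {N : Ω → PointMeasure E}
    (h : ∀ A : Set E, MeasurableSet A → Measurable fun ω => (N ω).1 A) : Measurable N :=
  Measurable.subtype_mk (Measure.measurable_of_measurable_coe _ h)

theorem PointMeasure.count_ne_top (m : PointMeasure E) {A : Set E} (hA : MeasurableSet A) :
    m.1 A ≠ ∞ := by
  obtain ⟨n, hn⟩ := m.2 A hA
  simp [hn]

/-- The point measure with unit atoms at the entries of a finite tuple. -/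
def tupleMeasure (k : ℕ) (x : Fin k → E) : PointMeasure E :=
  ⟨∑ i, Measure.dirac (x i), fun A hA => by
    classical
    refine ⟨∑ i, if x i ∈ A then 1 else 0, ?_⟩
    rw [Measure.finsetSum_apply]
    push_cast
    refine Finset.sum_congr rfl fun i _ => ?_
    rw [Measure.dirac_apply' _ hA]
    by_cases h : x i ∈ A <;> simp [h]⟩

theorem tupleMeasure_apply (k : ℕ) (x : Fin k → E) {A : Set E} (hA : MeasurableSet A) :
    (tupleMeasure k x).1 A = ∑ i, A.indicator 1 (x i) := by
  change (∑ i, Measure.dirac (x i) : Measure E) A = _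
  rw [Measure.finsetSum_apply]
  exact Finset.sum_congr rfl fun i _ => Measure.dirac_apply' _ hA

theorem tupleMeasure_toReal (k : ℕ) (x : Fin k → E) {A : Set E} (hA : MeasurableSet A) :
    ((tupleMeasure k x).1 A).toReal = ∑ i, A.indicator (fun _ => (1 : ℝ)) (x i) := by
  rw [tupleMeasure_apply k x hA, ENNReal.toReal_sum]
  · refine Finset.sum_congr rfl fun i _ => ?_
    by_cases h : x i ∈ A <;> simp [h]
  · intro i _
    by_cases h : x i ∈ A <;> simp [h]

theorem measurable_tupleMeasure (k : ℕ) : Measurable (tupleMeasure (E := E) k) := by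
  refine PointMeasure.measurable_of_count fun A hA => ?_
  simp_rw [tupleMeasure_apply k _ hA]
  exact Finset.measurable_sum _ fun i _ =>
    (measurable_one.indicator hA).comp (measurable_pi_apply i)

/-- The law of the Poisson point process with finite intensity measure `κ`. -/
def poissonLaw (κ : Measure E) : Measure (PointMeasure E) :=
  Measure.sum fun k : ℕ => ENNReal.ofReal (Real.exp (-κ.real Set.univ) / k.factorial) •
    (Measure.pi fun _ : Fin k => κ).map (tupleMeasure k)

instance (κ : Measure E) [IsFiniteMeasure κ] : IsProbabilityMeasure (poissonLaw κ) := by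
  refine ⟨?_⟩
  rw [poissonLaw, Measure.sum_apply _ MeasurableSet.univ]
  have h : ∀ k : ℕ, (ENNReal.ofReal (Real.exp (-κ.real Set.univ) / k.factorial) •
      (Measure.pi fun _ : Fin k => κ).map (tupleMeasure k)) Set.univ =
      ENNReal.ofReal (Real.exp (-κ.real Set.univ) * (κ.real Set.univ ^ k / k.factorial)) := by
    intro k
    rw [Measure.smul_apply, Measure.map_apply (measurable_tupleMeasure k) MeasurableSet.univ,
      Set.preimage_univ, Measure.pi_univ, Finset.prod_const, Finset.card_univ, Fintype.card_fin,
      ← ofReal_measureReal (measure_ne_top κ _), ← ENNReal.ofReal_pow measureReal_nonneg,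
      smul_eq_mul, ← ENNReal.ofReal_mul (by positivity)]
    congr 1
    ring
  simp_rw [h]
  rw [← ENNReal.ofReal_tsum_of_nonneg (fun k => by positivity)
    ((Real.summable_pow_div_factorial _).mul_left _), tsum_mul_left,
    ← congrFun (NormedSpace.exp_eq_tsum_div (𝔸 := ℝ)), ← Real.exp_eq_exp_ℝ, ← Real.exp_add]
  simp

/-- For a functional multiplicative over the atoms, the k-th term is the k-th power of the integral
of `g` over k!, and the exponential series sums up. -/
theorem integral_poissonLaw {κ : Measure E} [IsFiniteMeasure κ] {F : PointMeasure E → ℂ}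
    (hF : Measurable F) (hF1 : ∀ m, ‖F m‖ ≤ 1) {g : E → ℂ}
    (hg : ∀ k x, F (tupleMeasure k x) = ∏ i, g (x i)) :
    ∫ m, F m ∂(poissonLaw κ) = Complex.exp (∫ x, g x ∂κ - κ.real Set.univ) := by
  have hint : Integrable F (poissonLaw κ) :=
    Integrable.of_bound hF.aestronglyMeasurable 1 (.of_forall hF1)
  have h : ∀ k : ℕ, ∫ m, F m ∂(ENNReal.ofReal (Real.exp (-κ.real Set.univ) / k.factorial) •
      (Measure.pi fun _ : Fin k => κ).map (tupleMeasure k)) =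
      Complex.exp (-κ.real Set.univ) * ((∫ x, g x ∂κ) ^ k / k.factorial) := by
    intro k
    rw [integral_smul_measure, integral_map (measurable_tupleMeasure k).aemeasurable
      hF.aestronglyMeasurable]
    simp_rw [hg]
    rw [integral_fintype_prod_eq_pow, Fintype.card_fin, ENNReal.toReal_ofReal (by positivity),
      Complex.real_smul]
    push_cast
    ring
  rw [poissonLaw] at hint ⊢
  rw [integral_sum_measure hint]
  simp_rw [h]
  rw [tsum_mul_left, ← congrFun (NormedSpace.exp_eq_tsum_div (𝔸 := ℂ)), ← Complex.exp_eq_exp_ℂ,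
    ← Complex.exp_add]
  congr 1
  ring

/-- Joint characteristic function of the counts of disjoint sets. -/
theorem integral_exp_count_poissonLaw {κ : Measure E} [IsFiniteMeasure κ] {ι : Type*} [Fintype ι]
    {A : ι → Set E} (hA : ∀ i, MeasurableSet (A i))
    (hd : Pairwise fun i j => Disjoint (A i) (A j)) (t : ι → ℝ) :
    ∫ m, Complex.exp (((∑ j, t j * (m.1 (A j)).toReal : ℝ) : ℂ) * Complex.I) ∂(poissonLaw κ) =
      ∏ j, Complex.exp (κ.real (A j) * (Complex.exp (t j * Complex.I) - 1)) := by
  classical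
  let g : E → ℂ := fun x =>
    Complex.exp (((∑ j, t j * (A j).indicator (fun _ => (1 : ℝ)) x : ℝ) : ℂ) * Complex.I)
  -- At most one indicator is nonzero at `x`, so the exponential of the sum becomes affine in the
  -- indicators.
  have hgs : ∀ x, g x = 1 + ∑ j, (A j).indicator
      (fun _ => Complex.exp (t j * Complex.I) - 1) x := by
    intro x
    by_cases hx : ∃ j, x ∈ A j
    · obtain ⟨j, hj⟩ := hx
      have hne : ∀ i, i ≠ j → x ∉ A i := fun i hi hxi => (hd hi).le_bot ⟨hxi, hj⟩
      simp only [g]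
      rw [Finset.sum_eq_single j, Finset.sum_eq_single j]
      · simp [hj]
      · intro i _ hi; simp [hne i hi]
      · simp
      · intro i _ hi; simp [hne i hi]
      · simp
    · push Not at hx
      simp [g, hx]
  rw [integral_poissonLaw (g := g)]
  · rw [← Complex.exp_sum]
    congr 1
    simp_rw [hgs]
    have hi : ∀ j, Integrable ((A j).indicator
        (fun _ => Complex.exp (t j * Complex.I) - 1)) κ :=
      fun j => (integrable_const _).indicator (hA j)
    rw [integral_add (integrable_const _) (integrable_finsetSum _ fun j _ => hi j),
      integral_finsetSum _ fun j _ => hi j]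
    simp_rw [fun j => integral_indicator_const (μ := κ)
      (Complex.exp (t j * Complex.I) - 1) (hA j)]
    simp
  · have : ∀ j, Measurable fun m : PointMeasure E => (m.1 (A j)).toReal :=
      fun j => (measurable_count (hA j)).ennreal_toReal
    fun_prop
  · intro m
    rw [Complex.norm_exp_ofReal_mul_I]
  · intro k x
    rw [← Complex.exp_sum, ← Finset.sum_mul, ← Complex.ofReal_sum]
    congr 3
    simp_rw [tupleMeasure_toReal k x (hA _), Finset.mul_sum]
    exact Finset.sum_comm

theorem map_toReal_count_poissonLaw {κ : Measure E} [IsFiniteMeasure κ] {A : Set E}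
    (hA : MeasurableSet A) :
    (poissonLaw κ).map (fun m => (m.1 A).toReal) =
      (poissonMeasure (κ A).toNNReal).map (fun k : ℕ => (k : ℝ)) := by
  have hm : Measurable fun m : PointMeasure E => (m.1 A).toReal :=
    (measurable_count hA).ennreal_toReal
  have := Measure.isProbabilityMeasure_map (μ := poissonLaw κ) hm.aemeasurable
  refine Measure.ext_of_charFun ?_
  ext t
  rw [charFun_map_cast_poissonMeasure, charFun_apply_real, integral_map hm.aemeasurable
    (by fun_prop)]
  have := integral_exp_count_poissonLaw (κ := κ) (ι := Unit) (A := fun _ => A) (fun _ => hA)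
    (fun i j h => (h (Subsingleton.elim _ _)).elim) (fun _ => t)
  simpa [measureReal_def, ENNReal.coe_toNNReal_eq_toReal] using this

/-- Existence is essential: `maxRisk` is a supremum over Poisson laws and would vanish if there were
none. Independence holds because the joint characteristic function factors. -/
theorem isPoissonPointProcess_poissonLaw (hE : MeasurableSet E) (lam : ℝ≥0)
    (hvol : volume E ≠ ∞) :
    IsPoissonPointProcess (id : PointMeasure E → PointMeasure E)
      (poissonLaw (lam • Measure.comap Subtype.val volume)) lam E := by
  set κ : Measure E := lam • Measure.comap Subtype.val volume with hκ
  have hκA : ∀ A : Set E, MeasurableSet A → κ A = lam * volume (Subtype.val '' A) := by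
    intro A hA
    rw [hκ, Measure.smul_apply, comap_subtype_coe_apply hE, ENNReal.smul_def, smul_eq_mul]
  have : IsFiniteMeasure κ := by
    refine ⟨?_⟩
    rw [hκA _ MeasurableSet.univ, Set.image_univ, Subtype.range_coe]
    exact ENNReal.mul_lt_top ENNReal.coe_lt_top hvol.lt_top
  refine ⟨inferInstance, measurable_id, fun A hA => ?_, fun n A hA hd => ?_⟩
  · have hr : (fun m : PointMeasure E => (id m).1 A) =
        ENNReal.ofReal ∘ fun m : PointMeasure E => (m.1 A).toReal := by
      ext m
      exact (ENNReal.ofReal_toReal (m.count_ne_top hA)).symm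
    rw [hr, ← Measure.map_map ENNReal.measurable_ofReal (measurable_count hA).ennreal_toReal,
      map_toReal_count_poissonLaw hA, Measure.map_map ENNReal.measurable_ofReal (by fun_prop)]
    have : Subtype.val '' A ∩ E = Subtype.val '' A :=
      Set.inter_eq_left.2 (Subtype.coe_image_subset _ _)
    rw [this, hκA A hA, ENNReal.toNNReal_mul, ENNReal.toNNReal_coe]
    congr 1
    ext k
    simp
  · have hm : ∀ i, Measurable fun m : PointMeasure E => (m.1 (A i)).toReal :=
      fun i => (measurable_count (hA i)).ennreal_toReal
    have hind : iIndepFun (fun i (m : PointMeasure E) => (m.1 (A i)).toReal) (poissonLaw κ) := by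
      rw [iIndepFun_iff_charFun_pi fun i => (hm i).aemeasurable]
      intro t
      simp_rw [map_toReal_count_poissonLaw (hA _), charFun_map_cast_poissonMeasure]
      have hX : Measurable fun m : PointMeasure E =>
          WithLp.toLp 2 fun i => (m.1 (A i)).toReal :=
        (WithLp.measurable_toLp 2 _).comp (measurable_pi_lambda _ hm)
      rw [charFun_apply, integral_map hX.aemeasurable (by fun_prop)]
      have := integral_exp_count_poissonLaw (κ := κ) hA hd t
      simpa [measureReal_def, PiLp.inner_apply, ENNReal.coe_toNNReal_eq_toReal] using this
    have := hind.comp (fun _ => ENNReal.ofReal) fun _ => ENNReal.measurable_ofReal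
    convert this using 3 with i m
    exact (ENNReal.ofReal_toReal (m.count_ne_top (hA i))).symm

/-- The restriction of a point measure to the trace of a set on the state space. -/
def PointMeasure.restr (C : Set (EuclideanSpace ℝ (Fin d))) (hC : MeasurableSet C)
    (m : PointMeasure E) : PointMeasure E :=
  ⟨m.1.restrict (Subtype.val ⁻¹' C), fun A hA => by
    rw [Measure.restrict_apply hA]
    exact m.2 _ (hA.inter (measurable_subtype_coe hC))⟩

theorem PointMeasure.restr_apply {C : Set (EuclideanSpace ℝ (Fin d))} (hC : MeasurableSet C)
    (m : PointMeasure E) {A : Set E} (hA : MeasurableSet A) :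
    (m.restr C hC).1 A = m.1 (A ∩ Subtype.val ⁻¹' C) :=
  Measure.restrict_apply hA

theorem PointMeasure.measurable_restr {C : Set (EuclideanSpace ℝ (Fin d))}
    (hC : MeasurableSet C) : Measurable (PointMeasure.restr (E := E) C hC) := by
  refine PointMeasure.measurable_of_count fun A hA => ?_
  simp_rw [PointMeasure.restr_apply hC _ hA]
  exact measurable_count (hA.inter (measurable_subtype_coe hC))

/-- Restricting a Poisson point process on the state space to a subset `C` yields a Poisson
point process on `C`. -/
theorem IsPoissonPointProcess.map_restr {Q : Measure (PointMeasure E)} {lam : ℝ≥0}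
    (h : IsPoissonPointProcess (id : PointMeasure E → PointMeasure E) Q lam E)
    {C : Set (EuclideanSpace ℝ (Fin d))} (hC : MeasurableSet C) :
    IsPoissonPointProcess (id : PointMeasure E → PointMeasure E)
      (Q.map (PointMeasure.restr C hC)) lam C := by
  have := h.isProbabilityMeasure
  have hr := PointMeasure.measurable_restr (E := E) hC
  have hC' : MeasurableSet (Subtype.val ⁻¹' C : Set E) := measurable_subtype_coe hC
  have hp : IsProbabilityMeasure (Q.map (PointMeasure.restr C hC)) :=
    Measure.isProbabilityMeasure_map hr.aemeasurable
  refine ⟨hp, measurable_id, fun A hA => ?_,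
    fun n A hA hd => ?_⟩
  · change Measure.map (fun m : PointMeasure E => m.1 A) _ = _
    rw [Measure.map_map (measurable_count hA) hr]
    have := h.count_law _ (hA.inter hC')
    convert this using 6 with m
    · exact PointMeasure.restr_apply hC m hA
    · ext x
      constructor
      · rintro ⟨⟨y, hy, rfl⟩, hx⟩
        exact ⟨⟨y, ⟨hy, hx⟩, rfl⟩, y.2⟩
      · rintro ⟨⟨y, ⟨hy, hx⟩, rfl⟩, -⟩
        exact ⟨⟨y, hy, rfl⟩, hx⟩
  · have := h.indep n (fun i => A i ∩ Subtype.val ⁻¹' C) (fun i => (hA i).inter hC')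
      fun i j hij => (hd hij).mono Set.inter_subset_left Set.inter_subset_left
    change iIndepFun (fun i (m : PointMeasure E) => m.1 (A i)) _
    change iIndepFun (fun i (m : PointMeasure E) => m.1 (A i ∩ Subtype.val ⁻¹' C)) _ at this
    rw [iIndepFun_iff_map_fun_eq_pi_map fun i => (measurable_count (hA i)).aemeasurable]
    rw [iIndepFun_iff_map_fun_eq_pi_map
      fun i => (measurable_count ((hA i).inter hC')).aemeasurable] at this
    have hm : ∀ i, (Q.map (PointMeasure.restr C hC)).map (fun m : PointMeasure E => m.1 (A i)) =
        Q.map (fun m : PointMeasure E => m.1 (A i ∩ Subtype.val ⁻¹' C)) := by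
      intro i
      rw [Measure.map_map (measurable_count (hA i)) hr]
      congr 1
      ext m
      exact PointMeasure.restr_apply hC m (hA i)
    simp_rw [hm]
    rw [← this, Measure.map_map (measurable_pi_lambda _ fun i => measurable_count (hA i)) hr]
    congr 1
    ext m i
    exact PointMeasure.restr_apply hC m (hA i)

/-- The void probability is the only quantitative fact about the process that the lower bound uses.
-/
theorem IsPoissonPointProcess.measure_count_eq_zero {Q : Measure (PointMeasure E)} {lam : ℝ≥0}
    (h : IsPoissonPointProcess (id : PointMeasure E → PointMeasure E) Q lam E)
    {D : Set (EuclideanSpace ℝ (Fin d))} (hD : MeasurableSet D) :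
    Q {m | m.1 (Subtype.val ⁻¹' D) = 0} =
      ENNReal.ofReal (Real.exp (-(lam * volume.real (D ∩ E)))) := by
  have hD' : MeasurableSet (Subtype.val ⁻¹' D : Set E) := measurable_subtype_coe hD
  have h1 := h.count_law _ hD'
  have h2 := congrArg (fun μ : Measure ℝ≥0∞ => μ {0}) h1
  change Measure.map (fun m : PointMeasure E => m.1 (Subtype.val ⁻¹' D)) Q {0} =
    Measure.map _ _ {0} at h2
  rw [Measure.map_apply (measurable_count hD') (measurableSet_singleton _),
    Measure.map_apply (by fun_prop) (measurableSet_singleton _)] at h2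
  have h3 : (fun k : ℕ => (k : ℝ≥0∞)) ⁻¹' {0} = {0} := by ext k; simp
  rw [h3, poissonMeasure_singleton] at h2
  have h4 : Subtype.val '' (Subtype.val ⁻¹' D : Set E) ∩ E = D ∩ E := by
    rw [Subtype.image_preimage_coe, Set.inter_comm E D, Set.inter_assoc, Set.inter_self]
  rw [h4] at h2
  refine h2.trans ?_
  simp [measureReal_def, ENNReal.coe_toNNReal_eq_toReal]

end Poisson

/-! ### Orthogonality of random signs. -/

section Signs

variable {ι : Type*} [DecidableEq ι]

/-- The sign `±1` of a Boolean. -/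
def boolSign (b : Bool) : ℝ := if b then 1 else -1

theorem boolSign_mul_self (b : Bool) : boolSign b * boolSign b = 1 := by
  cases b <;> simp [boolSign]

theorem boolSign_not (b : Bool) : boolSign (!b) = -boolSign b := by
  cases b <;> simp [boolSign]

/-- Flipping the coordinates of a Boolean vector in `J`. -/
def flipOn (J : Finset ι) : Equiv.Perm (ι → Bool) :=
  Function.Involutive.toPerm (fun ω i => if i ∈ J then !ω i else ω i) fun ω => by
    ext i
    by_cases h : i ∈ J <;> simp [h]

theorem flipOn_apply (J : Finset ι) (ω : ι → Bool) (i : ι) :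
    flipOn J ω i = if i ∈ J then !ω i else ω i := rfl

variable [Fintype ι]

/-- For distinct indices, flipping coordinate `i` is a bijection that reverses the sign of every
summand. -/
theorem sum_boolSign_mul (i j : ι) :
    ∑ ω : ι → Bool, boolSign (ω i) * boolSign (ω j) =
      if i = j then (2 : ℝ) ^ Fintype.card ι else 0 := by
  split_ifs with h
  · subst h
    simp [boolSign_mul_self]
  · have h1 := Equiv.sum_comp (flipOn {i}) fun ω : ι → Bool => boolSign (ω i) * boolSign (ω j)
    have h2 : ∀ ω : ι → Bool, boolSign (flipOn {i} ω i) * boolSign (flipOn {i} ω j) =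
        -(boolSign (ω i) * boolSign (ω j)) := by
      intro ω
      simp [flipOn_apply, Ne.symm h, boolSign_not]
    simp_rw [h2, Finset.sum_neg_distrib] at h1
    linarith

theorem sum_sq_sum_boolSign (J : Finset ι) (v : ι → ℝ) :
    ∑ ω : ι → Bool, (∑ i ∈ J, v i * boolSign (ω i)) ^ 2 =
      2 ^ Fintype.card ι * ∑ i ∈ J, v i ^ 2 := by
  simp_rw [sq, Finset.sum_mul_sum]
  rw [Finset.sum_comm, Finset.mul_sum]
  refine Finset.sum_congr rfl fun i hi => ?_
  rw [Finset.sum_comm]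
  have h : ∀ j ∈ J, ∑ ω : ι → Bool, v i * boolSign (ω i) * (v j * boolSign (ω j)) =
      if i = j then 2 ^ Fintype.card ι * (v i * v i) else 0 := by
    intro j _
    have : ∀ ω : ι → Bool, v i * boolSign (ω i) * (v j * boolSign (ω j)) =
        v i * v j * (boolSign (ω i) * boolSign (ω j)) := fun ω => by ring
    simp_rw [this]
    rw [← Finset.mul_sum, sum_boolSign_mul]
    split_ifs with hij
    · subst hij; ring
    · ring
  rw [Finset.sum_congr rfl h, Finset.sum_ite_eq, if_pos hi]

/-- A quantity `f` blind to the coordinates in `J` estimates an additive functional of a uniformly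
random Boolean vector with mean squared error at least a quarter of `∑ i ∈ J, v i ^ 2`. -/
theorem le_sum_sq_sub_of_flip_invariant (J : Finset ι) (v : ι → ℝ) (a : ℝ)
    (f : (ι → Bool) → ℝ) (hf : ∀ ω, f (flipOn J ω) = f ω) :
    2 ^ Fintype.card ι * ((∑ i ∈ J, v i ^ 2) / 4) ≤
      ∑ ω : ι → Bool, (a - (∑ i, if ω i then 0 else v i) - f ω) ^ 2 := by
  set S : (ι → Bool) → ℝ := fun ω => a - ∑ i, if ω i then 0 else v i with hS
  have hdiff : ∀ ω, S ω - S (flipOn J ω) = ∑ i ∈ J, v i * boolSign (ω i) := by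
    intro ω
    simp only [hS]
    rw [sub_sub_sub_cancel_left, ← Finset.sum_sub_distrib,
      ← Finset.sum_subset (Finset.subset_univ J)]
    · refine Finset.sum_congr rfl fun i hi => ?_
      cases h : ω i <;> simp [flipOn_apply, hi, h, boolSign]
    · intro i _ hi
      simp [flipOn_apply, hi]
  have hflip : ∑ ω, (S (flipOn J ω) - f ω) ^ 2 = ∑ ω, (S ω - f ω) ^ 2 := by
    rw [← Equiv.sum_comp (flipOn J) fun ω => (S ω - f ω) ^ 2]
    simp_rw [hf]
  -- This is (x - y)² ≤ 2x² + 2y². As `f` is flip invariant, both error sums coincide by reindexing,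
  -- whence the factor 1/4.
  have hle : ∑ ω : ι → Bool, (∑ i ∈ J, v i * boolSign (ω i)) ^ 2 ≤
      ∑ ω, (2 * (S ω - f ω) ^ 2 + 2 * (S (flipOn J ω) - f ω) ^ 2) := by
    refine Finset.sum_le_sum fun ω _ => ?_
    rw [← hdiff]
    nlinarith [sq_nonneg ((S ω - f ω) + (S (flipOn J ω) - f ω))]
  rw [sum_sq_sum_boolSign, Finset.sum_add_distrib, ← Finset.mul_sum, ← Finset.mul_sum,
    hflip] at hle
  linarith

end Signs

/-! ### Averaging the risk over a hypercube of pruned sets. -/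

section Hypercube

variable {d : ℕ} {E : Set (EuclideanSpace ℝ (Fin d))} {ι : Type*} [Fintype ι]

/-- The set `K` with the pieces `D i` removed for which `ω i` is false. -/
def prune (K : Set (EuclideanSpace ℝ (Fin d))) (D : ι → Set (EuclideanSpace ℝ (Fin d)))
    (ω : ι → Bool) : Set (EuclideanSpace ℝ (Fin d)) :=
  K \ ⋃ i, ⋃ _ : ω i = false, D i

variable {K : Set (EuclideanSpace ℝ (Fin d))} {D : ι → Set (EuclideanSpace ℝ (Fin d))}

theorem measurableSet_prune (hK : MeasurableSet K) (hD : ∀ i, MeasurableSet (D i))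
    (ω : ι → Bool) : MeasurableSet (prune K D ω) :=
  hK.diff (MeasurableSet.iUnion fun i => MeasurableSet.iUnion fun _ => hD i)

theorem volume_real_prune (hKfin : volume K ≠ ∞) (hD : ∀ i, MeasurableSet (D i))
    (hDK : ∀ i, D i ⊆ K) (hdisj : Pairwise fun i j => Disjoint (D i) (D j)) (ω : ι → Bool) :
    volume.real (prune K D ω) =
      volume.real K - ∑ i, if ω i then 0 else volume.real (D i) := by
  classical
  have hU : (⋃ i, ⋃ _ : ω i = false, D i) =
      ⋃ i ∈ Finset.univ.filter (fun i => ω i = false), D i := by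
    simp
  have hsub : (⋃ i, ⋃ _ : ω i = false, D i) ⊆ K :=
    Set.iUnion_subset fun i => Set.iUnion_subset fun _ => hDK i
  rw [prune, measureReal_sdiff hsub
    (MeasurableSet.iUnion fun i => MeasurableSet.iUnion fun _ => hD i) hKfin, hU,
    measureReal_biUnion_finset (fun i _ j _ hij => hdisj hij) (fun i _ => hD i)
      (fun i _ => measure_ne_top_of_subset (hDK i) hKfin), Finset.sum_filter]
  congr 1
  refine Finset.sum_congr rfl fun i _ => ?_
  cases ω i <;> simp

/-- The two pruned sets differ only inside pieces that `m` does not charge. -/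
theorem restr_prune_flipOn [DecidableEq ι] (hK : MeasurableSet K)
    (hD : ∀ i, MeasurableSet (D i)) (m : PointMeasure E) (J : Finset ι)
    (hJ : ∀ i ∈ J, m.1 (Subtype.val ⁻¹' D i : Set E) = 0) (ω : ι → Bool) :
    m.restr (prune K D (flipOn J ω)) (measurableSet_prune hK hD _) =
      m.restr (prune K D ω) (measurableSet_prune hK hD _) := by
  refine Subtype.ext (Measure.restrict_congr_set ?_)
  have hnull : ∀ᵐ x : E ∂m.1, ∀ i ∈ J, (x : EuclideanSpace ℝ (Fin d)) ∉ D i := by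
    refine (ae_ball_iff (p := fun (x : E) i _ => x.1 ∉ D i) J.countable_toSet).2 ?_
    intro i hi
    exact (measure_eq_zero_iff_ae_notMem (μ := m.1)
      (s := (Subtype.val : E → EuclideanSpace ℝ (Fin d)) ⁻¹' D i)).1 (hJ i hi)
  refine hnull.mono fun x hx => propext ?_
  change (x : EuclideanSpace ℝ (Fin d)) ∈ prune K D _ ↔ x.1 ∈ prune K D _
  simp only [prune, Set.mem_sdiff, Set.mem_iUnion, not_exists]
  refine and_congr_right fun _ => forall_congr' fun i => ?_
  by_cases hi : i ∈ J
  · simp [hx i hi]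
  · simp [flipOn_apply, hi]

/-- Lower bound for the maximal risk from a hypercube of convex sets. -/
theorem le_maxRisk_of_prune {Q : Measure (PointMeasure E)} {lam : ℝ≥0}
    (hQ : IsPoissonPointProcess (id : PointMeasure E → PointMeasure E) Q lam E)
    (hKE : K ⊆ E) (hK : MeasurableSet K) (hKfin : volume K ≠ ∞)
    (hD : ∀ i, MeasurableSet (D i)) (hDK : ∀ i, D i ⊆ K)
    (hdisj : Pairwise fun i j => Disjoint (D i) (D j))
    (hC : ∀ ω, prune K D ω ∈ ConvexClass E)
    {θ : PointMeasure E → ℝ} (hθ : Measurable θ) :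
    ENNReal.ofReal ((∑ i, volume.real (D i) ^ 2 * Real.exp (-(lam * volume.real (D i)))) / 4) ≤
      maxRisk E lam θ := by
  classical
  -- The coupling: one process on `E` provides the data for all vertices of the hypercube.
  let R : (ι → Bool) → PointMeasure E → PointMeasure E := fun ω m =>
    m.restr (prune K D ω) (measurableSet_prune hK hD ω)
  have hR : ∀ ω, Measurable (R ω) := fun ω => PointMeasure.measurable_restr _
  have hterm : ∀ ω, ∫⁻ m, ENNReal.ofReal ((volume.real (prune K D ω) - θ (R ω m)) ^ 2) ∂Q ≤
      maxRisk E lam θ := by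
    intro ω
    have hP := hQ.map_restr (measurableSet_prune hK hD ω)
    have : ∫⁻ m, ENNReal.ofReal ((volume.real (prune K D ω) - θ m) ^ 2) ∂(Q.map (R ω)) ≤
        maxRisk E lam θ :=
      le_iSup_of_le (prune K D ω) <| le_iSup_of_le (hC ω) <| le_iSup_of_le _ <|
        le_iSup_of_le hP le_rfl
    rwa [lintegral_map (by fun_prop) (hR ω)] at this
  have hpt : ∀ m : PointMeasure E,
      2 ^ Fintype.card ι * ((∑ i, {m : PointMeasure E | m.1 (Subtype.val ⁻¹' D i) = 0}.indicator
        (fun _ => ENNReal.ofReal (volume.real (D i) ^ 2 / 4)) m)) ≤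
      ∑ ω, ENNReal.ofReal ((volume.real (prune K D ω) - θ (R ω m)) ^ 2) := by
    intro m
    -- The empty pieces depend on `m` but not on `ω`, so the sign lemma applies for each fixed `m`.
    set J : Finset ι := Finset.univ.filter fun i => m.1 (Subtype.val ⁻¹' D i) = 0 with hJ
    have h1 := le_sum_sq_sub_of_flip_invariant J (fun i => volume.real (D i)) (volume.real K)
      (fun ω => θ (R ω m)) fun ω => congrArg θ
        (restr_prune_flipOn hK hD m J (fun i hi => by simpa [hJ] using hi) ω)
    simp_rw [← volume_real_prune hKfin hD hDK hdisj] at h1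
    have h2 := ENNReal.ofReal_le_ofReal h1
    rw [ENNReal.ofReal_sum_of_nonneg fun _ _ => sq_nonneg _,
      ENNReal.ofReal_mul (by positivity), Finset.sum_div,
      ENNReal.ofReal_sum_of_nonneg fun _ _ => by positivity, ENNReal.ofReal_pow zero_le_two,
      ENNReal.ofReal_ofNat, hJ, Finset.sum_filter] at h2
    refine le_trans (le_of_eq ?_) h2
    congr 1
    exact Finset.sum_congr rfl fun i _ => by rw [Set.indicator_apply]; rfl
  have hmeas : ∀ i, MeasurableSet {m : PointMeasure E | m.1 (Subtype.val ⁻¹' D i) = 0} :=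
    fun i => measurable_count (measurable_subtype_coe (hD i)) (measurableSet_singleton 0)
  have hint := lintegral_mono (μ := Q) hpt
  rw [lintegral_const_mul _ (Finset.measurable_sum _ fun i _ =>
      measurable_const.indicator (hmeas i)),
    lintegral_finsetSum _ fun i _ => measurable_const.indicator (hmeas i),
    lintegral_finsetSum _ fun ω _ => by
      have := hR ω
      fun_prop] at hint
  simp_rw [lintegral_indicator_const (hmeas _), hQ.measure_count_eq_zero (hD _)] at hint
  -- The average over the vertices is at most the maximum; the factor 2^|ι| then cancels.
  have hsum := hint.trans (Finset.sum_le_card_nsmul Finset.univ _ _ fun ω _ => hterm ω)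
  rw [Finset.card_univ, Fintype.card_fun, Fintype.card_bool, nsmul_eq_mul, Nat.cast_pow,
    Nat.cast_ofNat, ENNReal.mul_le_mul_iff_right (by simp) (by simp)] at hsum
  refine le_trans (le_of_eq ?_) hsum
  rw [Finset.sum_div, ENNReal.ofReal_sum_of_nonneg fun _ _ => by positivity]
  refine Finset.sum_congr rfl fun i _ => ?_
  rw [Set.inter_eq_left.2 ((hDK i).trans hKE), ← ENNReal.ofReal_mul (by positivity)]
  congr 1
  ring

end Hypercube

/-! ### Caps of a paraboloid: disjointness, volume, location. -/

section Caps

variable {n : ℕ}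

/-- The height of `z` above the hyperplane tangent at the abscissa `c` to the paraboloid
with apex `p` and axis in direction of the zeroth coordinate. -/
def tangentGap (p : EuclideanSpace ℝ (Fin (n + 1))) (c : Fin n → ℝ)
    (z : EuclideanSpace ℝ (Fin (n + 1))) : ℝ :=
  z 0 - p 0 - ∑ j : Fin n, (2 * c j * (z j.succ - p j.succ) - c j ^ 2)

/-- The solid paraboloid with apex `p`. -/
def paraboloid (p : EuclideanSpace ℝ (Fin (n + 1))) : Set (EuclideanSpace ℝ (Fin (n + 1))) :=
  {z | ∀ c, 0 ≤ tangentGap p c z}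

/-- The cap of height `δ ^ 2` cut from the paraboloid at the abscissa `c`. -/
def cap (p : EuclideanSpace ℝ (Fin (n + 1))) (δ : ℝ) (c : Fin n → ℝ) :
    Set (EuclideanSpace ℝ (Fin (n + 1))) :=
  paraboloid p ∩ {z | tangentGap p c z < δ ^ 2}

variable {p z : EuclideanSpace ℝ (Fin (n + 1))} {c : Fin n → ℝ} {δ : ℝ}

/-- Completing the square splits the gap into the height above the paraboloid and the squared
horizontal distance to `c`. Both are nonnegative on the paraboloid, which confines a cap of height
δ² to horizontal distance below δ. -/
theorem tangentGap_eq :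
    tangentGap p c z = z 0 - p 0 - ∑ j : Fin n, (z j.succ - p j.succ) ^ 2 +
      ∑ j : Fin n, (z j.succ - p j.succ - c j) ^ 2 := by
  rw [tangentGap, sub_add, ← Finset.sum_sub_distrib]
  congr 1
  exact Finset.sum_congr rfl fun j _ => by ring

theorem mem_paraboloid :
    z ∈ paraboloid p ↔ ∑ j : Fin n, (z j.succ - p j.succ) ^ 2 ≤ z 0 - p 0 := by
  constructor
  · intro h
    have := h fun j => z j.succ - p j.succ
    rw [tangentGap_eq] at this
    simpa using this
  · intro h c
    rw [tangentGap_eq]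
    have := Finset.sum_nonneg fun (j : Fin n) (_ : j ∈ Finset.univ) =>
      sq_nonneg (z j.succ - p j.succ - c j)
    linarith

theorem continuous_tangentGap (p : EuclideanSpace ℝ (Fin (n + 1))) (c : Fin n → ℝ) :
    Continuous (tangentGap p c) := by
  unfold tangentGap
  fun_prop

theorem isClosed_le_tangentGap (p : EuclideanSpace ℝ (Fin (n + 1))) (c : Fin n → ℝ) (s : ℝ) :
    IsClosed {z | s ≤ tangentGap p c z} :=
  isClosed_le continuous_const (continuous_tangentGap p c)

/-- The gap is affine in `z`, so this is a half-space. -/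
theorem convex_le_tangentGap (p : EuclideanSpace ℝ (Fin (n + 1))) (c : Fin n → ℝ) (s : ℝ) :
    Convex ℝ {z | s ≤ tangentGap p c z} := by
  intro x hx y hy a b ha hb hab
  have h : tangentGap p c (a • x + b • y) = a * tangentGap p c x + b * tangentGap p c y := by
    obtain rfl : b = 1 - a := by linarith
    simp only [tangentGap, mul_sub, Finset.mul_sum, PiLp.add_apply, PiLp.smul_apply, smul_eq_mul]
    rw [sub_add_sub_comm, ← Finset.sum_add_distrib]
    congr 1
    · ring
    · exact Finset.sum_congr rfl fun j _ => by ring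
  simp only [Set.mem_ofPred_eq] at *
  rw [h]
  calc s = a * s + b * s := by rw [← add_mul, hab, one_mul]
    _ ≤ _ := add_le_add (mul_le_mul_of_nonneg_left hx ha) (mul_le_mul_of_nonneg_left hy hb)

theorem paraboloid_eq_iInter (p : EuclideanSpace ℝ (Fin (n + 1))) :
    paraboloid p = ⋂ c, {z | 0 ≤ tangentGap p c z} := by
  ext z
  simp [paraboloid]

theorem isClosed_paraboloid (p : EuclideanSpace ℝ (Fin (n + 1))) : IsClosed (paraboloid p) := by
  rw [paraboloid_eq_iInter]
  exact isClosed_iInter fun c => isClosed_le_tangentGap p c 0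

theorem convex_paraboloid (p : EuclideanSpace ℝ (Fin (n + 1))) : Convex ℝ (paraboloid p) := by
  rw [paraboloid_eq_iInter]
  exact convex_iInter fun c => convex_le_tangentGap p c 0

theorem measurableSet_cap (p : EuclideanSpace ℝ (Fin (n + 1))) (δ : ℝ) (c : Fin n → ℝ) :
    MeasurableSet (cap p δ c) :=
  (isClosed_paraboloid p).measurableSet.inter
    (isOpen_lt (continuous_tangentGap p c) continuous_const).measurableSet

theorem abs_lt_of_mem_cap (hδ : 0 < δ) (h : z ∈ cap p δ c) (j : Fin n) :
    |z j.succ - p j.succ - c j| < δ := by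
  have h1 := mem_paraboloid.1 h.1
  have h2 : tangentGap p c z < δ ^ 2 := h.2
  rw [tangentGap_eq] at h2
  have h3 := Finset.single_le_sum (f := fun j => (z j.succ - p j.succ - c j) ^ 2)
    (fun j _ => sq_nonneg _) (Finset.mem_univ j)
  exact abs_lt_of_sq_lt_sq (by simp only at h3; linarith) hδ.le

theorem disjoint_cap (hδ : 0 < δ) {c' : Fin n → ℝ} (j : Fin n) (hj : 2 * δ ≤ |c j - c' j|) :
    Disjoint (cap p δ c) (cap p δ c') := by
  rw [Set.disjoint_left]
  intro z h h'
  have h1 := abs_lt.1 (abs_lt_of_mem_cap hδ h j)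
  have h2 := abs_lt.1 (abs_lt_of_mem_cap hδ h' j)
  have : |c j - c' j| < 2 * δ := abs_lt.2 ⟨by linarith, by linarith⟩
  linarith

theorem volume_region {f g : (Fin n → ℝ) → ℝ} (hf : Measurable f) (hg : Measurable g) :
    volume {z : EuclideanSpace ℝ (Fin (n + 1)) |
      f (fun j => z j.succ) ≤ z 0 ∧ z 0 < g (fun j => z j.succ)} =
      ∫⁻ x, ENNReal.ofReal (g x - f x) := by
  set S : Set (ℝ × (Fin n → ℝ)) := {q | f q.2 ≤ q.1 ∧ q.1 < g q.2} with hS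
  have hSm : MeasurableSet S :=
    (measurableSet_le (hf.comp measurable_snd) measurable_fst).inter
      (measurableSet_lt measurable_fst (hg.comp measurable_snd))
  have hmp := (volume_preserving_piFinSuccAbove (fun _ : Fin (n + 1) => ℝ) 0).comp
    (PiLp.volume_preserving_ofLp (Fin (n + 1)))
  have h := hmp.measure_preimage hSm.nullMeasurableSet
  rw [Measure.volume_eq_prod, Measure.prod_apply_symm hSm] at h
  have hsl : ∀ x : Fin n → ℝ, (fun y : ℝ => (y, x)) ⁻¹' S = Set.Ico (f x) (g x) := fun x => rfl
  simp_rw [hsl, Real.volume_Ico] at h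
  exact h

theorem cap_eq_region (p : EuclideanSpace ℝ (Fin (n + 1))) (δ : ℝ) (c : Fin n → ℝ) :
    cap p δ c = {z | p 0 + ∑ j : Fin n, (z j.succ - p j.succ) ^ 2 ≤ z 0 ∧
      z 0 < p 0 + ∑ j : Fin n, (z j.succ - p j.succ) ^ 2 +
        (δ ^ 2 - ∑ j : Fin n, (z j.succ - p j.succ - c j) ^ 2)} := by
  ext z
  rw [cap, Set.mem_inter_iff, mem_paraboloid, Set.mem_ofPred_eq, Set.mem_ofPred_eq, tangentGap_eq]
  constructor <;> rintro ⟨h1, h2⟩ <;> exact ⟨by linarith, by linarith⟩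

theorem volume_cap (p : EuclideanSpace ℝ (Fin (n + 1))) (δ : ℝ) (c : Fin n → ℝ) :
    volume (cap p δ c) =
      ∫⁻ x : Fin n → ℝ, ENNReal.ofReal (δ ^ 2 - ∑ j : Fin n, (x j - (p j.succ + c j)) ^ 2) := by
  rw [cap_eq_region]
  refine (volume_region (f := fun x => p 0 + ∑ j : Fin n, (x j - p j.succ) ^ 2)
    (g := fun x => p 0 + ∑ j : Fin n, (x j - p j.succ) ^ 2 +
      (δ ^ 2 - ∑ j : Fin n, (x j - p j.succ - c j) ^ 2)) (by fun_prop) (by fun_prop)).trans ?_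
  simp only [add_sub_cancel_left, sub_sub]

/-- The cap's vertical thickness is at most δ² and vanishes outside a sup-norm ball of radius δ. -/
theorem volume_cap_le (p : EuclideanSpace ℝ (Fin (n + 1))) (hδ : 0 < δ) (c : Fin n → ℝ) :
    volume (cap p δ c) ≤ ENNReal.ofReal (2 ^ n * δ ^ (n + 2)) := by
  set b : Fin n → ℝ := fun j => p j.succ + c j with hb
  have h : ∀ x : Fin n → ℝ, ENNReal.ofReal (δ ^ 2 - ∑ j : Fin n, (x j - (p j.succ + c j)) ^ 2) ≤
      (Metric.closedBall b δ).indicator (fun _ => ENNReal.ofReal (δ ^ 2)) x := by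
    intro x
    by_cases hx : x ∈ Metric.closedBall b δ
    · rw [Set.indicator_of_mem hx]
      exact ENNReal.ofReal_le_ofReal
        (sub_le_self _ (Finset.sum_nonneg fun j _ => sq_nonneg _))
    · rw [Set.indicator_of_notMem hx, nonpos_iff_eq_zero, ENNReal.ofReal_eq_zero, sub_nonpos]
      rw [Metric.mem_closedBall, dist_pi_le_iff hδ.le] at hx
      push Not at hx
      obtain ⟨j, hj⟩ := hx
      rw [Real.dist_eq] at hj
      have h3 := Finset.single_le_sum (f := fun j => (x j - (p j.succ + c j)) ^ 2)
        (fun j _ => sq_nonneg _) (Finset.mem_univ j)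
      refine le_trans ?_ h3
      rw [← sq_abs (x j - _)]
      exact pow_le_pow_left₀ hδ.le hj.le 2
  rw [volume_cap]
  refine (lintegral_mono h).trans (le_of_eq ?_)
  rw [lintegral_indicator_const Metric.isClosed_closedBall.measurableSet,
    Real.volume_pi_closedBall _ hδ.le, Fintype.card_fin, ← ENNReal.ofReal_mul (by positivity)]
  congr 1
  ring

/-- On the sup-norm ball of radius δ/(n+1) the thickness is at least δ²/2, because n/(n+1)² ≤ 1/2.
-/
theorem le_volume_cap (p : EuclideanSpace ℝ (Fin (n + 1))) (hδ : 0 < δ) (c : Fin n → ℝ) :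
    ENNReal.ofReal ((2 / (n + 1)) ^ n / 2 * δ ^ (n + 2)) ≤ volume (cap p δ c) := by
  set b : Fin n → ℝ := fun j => p j.succ + c j with hb
  have hr : 0 ≤ δ / (n + 1) := by positivity
  have h : ∀ x : Fin n → ℝ, (Metric.closedBall b (δ / (n + 1))).indicator
      (fun _ => ENNReal.ofReal (δ ^ 2 / 2)) x ≤
      ENNReal.ofReal (δ ^ 2 - ∑ j : Fin n, (x j - (p j.succ + c j)) ^ 2) := by
    intro x
    by_cases hx : x ∈ Metric.closedBall b (δ / (n + 1))
    · rw [Set.indicator_of_mem hx]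
      refine ENNReal.ofReal_le_ofReal ?_
      rw [Metric.mem_closedBall, dist_pi_le_iff hr] at hx
      have h1 : ∑ j : Fin n, (x j - (p j.succ + c j)) ^ 2 ≤ n * (δ / (n + 1)) ^ 2 := by
        refine (Finset.sum_le_card_nsmul _ _ ((δ / (n + 1)) ^ 2) fun j _ => ?_).trans
          (le_of_eq (by simp))
        have := hx j
        rw [Real.dist_eq] at this
        rw [← sq_abs]
        exact pow_le_pow_left₀ (abs_nonneg _) this 2
      have h2 : (n : ℝ) * (δ / (n + 1)) ^ 2 ≤ δ ^ 2 / 2 := by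
        rw [div_pow, mul_div_assoc', div_le_div_iff₀ (by positivity) (by positivity)]
        nlinarith [mul_nonneg (sq_nonneg δ) (sq_nonneg (n : ℝ)), sq_nonneg δ]
      linarith
    · rw [Set.indicator_of_notMem hx]
      exact zero_le
  rw [volume_cap]
  refine le_trans (le_of_eq ?_) (lintegral_mono h)
  rw [lintegral_indicator_const Metric.isClosed_closedBall.measurableSet,
    Real.volume_pi_closedBall _ hr, Fintype.card_fin, ← ENNReal.ofReal_mul (by positivity)]
  congr 1
  rw [← mul_div_assoc, mul_div_right_comm, mul_pow]
  ring

theorem norm_le_sum_abs {ι : Type*} [Fintype ι] (x : EuclideanSpace ℝ ι) :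
    ‖x‖ ≤ ∑ i, |x i| := by
  refine abs_le_of_sq_le_sq' ?_ (Finset.sum_nonneg fun i _ => abs_nonneg _) |>.2
  rw [EuclideanSpace.norm_sq_eq]
  exact Finset.sum_sq_le_sq_sum_of_nonneg fun i _ => abs_nonneg _

/-- Horizontal coordinates contribute at most 2na and the height at most (4n+1)a, using a ≤ 1 to
bound squares. The slack beyond 6n + 1 later gives δ² < r/2. -/
theorem cap_subset_ball {a r : ℝ} (hδ : 0 < δ) (hδa : δ ≤ a) (ha : a ≤ 1)
    (har : (6 * n + 3) * a < r) (hc : ∀ j, |c j| ≤ a) :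
    cap p δ c ⊆ Metric.ball p r := by
  intro z hz
  have hx : ∀ j : Fin n, |z j.succ - p j.succ| ≤ 2 * a := by
    intro j
    have h1 := abs_lt.1 (abs_lt_of_mem_cap hδ hz j)
    have h2 := abs_le.1 (hc j)
    exact abs_le.2 ⟨by linarith, by linarith⟩
  have h1 : ∑ j : Fin n, |z j.succ - p j.succ| ≤ n * (2 * a) :=
    (Finset.sum_le_card_nsmul _ _ (2 * a) fun j _ => hx j).trans (le_of_eq (by simp))
  have h2 : ∑ j : Fin n, (z j.succ - p j.succ) ^ 2 ≤ n * (4 * a) := by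
    refine (Finset.sum_le_card_nsmul _ _ (4 * a) fun j _ => ?_).trans (le_of_eq (by simp))
    rw [← sq_abs]
    nlinarith [hx j, abs_nonneg (z j.succ - p j.succ)]
  have h3 := mem_paraboloid.1 hz.1
  have h4 : tangentGap p c z < δ ^ 2 := hz.2
  rw [tangentGap_eq] at h4
  have h5 := Finset.sum_nonneg fun (j : Fin n) (_ : j ∈ Finset.univ) =>
      sq_nonneg (z j.succ - p j.succ - c j)
  have h6 := Finset.sum_nonneg fun (j : Fin n) (_ : j ∈ Finset.univ) =>
      sq_nonneg (z j.succ - p j.succ)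
  have h7 : |z 0 - p 0| ≤ n * (4 * a) + a := by
    rw [abs_of_nonneg (h6.trans h3)]
    nlinarith
  rw [Metric.mem_ball, dist_eq_norm]
  refine (norm_le_sum_abs _).trans_lt ?_
  rw [Fin.sum_univ_succ]
  simp only [PiLp.sub_apply]
  nlinarith

end Caps

/-! ### The grid of caps and the choice of scale. -/

section LowerBound

variable {n : ℕ} {E : Set (EuclideanSpace ℝ (Fin (n + 1)))} {p : EuclideanSpace ℝ (Fin (n + 1))}

/-- Inside the paraboloid, deleting a cap means keeping the complementary closed half-space;
convexity and closedness follow. -/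
theorem prune_cap_eq {ι : Type*} (p : EuclideanSpace ℝ (Fin (n + 1))) (δ : ℝ) (c : ι → Fin n → ℝ)
    (ω : ι → Bool) :
    prune (E ∩ paraboloid p) (fun i => cap p δ (c i)) ω =
      E ∩ paraboloid p ∩ ⋂ i, ⋂ _ : ω i = false, {z | δ ^ 2 ≤ tangentGap p (c i) z} := by
  ext z
  simp only [prune, cap, Set.mem_sdiff, Set.mem_iUnion, Set.mem_inter_iff, Set.mem_iInter,
    Set.mem_ofPred_eq, not_exists, not_and, not_lt]
  exact ⟨fun h => ⟨h.1, fun i hi => h.2 i hi h.1.2⟩, fun h => ⟨h.1, fun i hi _ => h.2 i hi⟩⟩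

theorem prune_cap_mem_convexClass {ι : Type*} {r δ : ℝ} (hEcompact : IsCompact E)
    (hEconvex : Convex ℝ E) (hr : 0 < r) (hball : Metric.ball p r ⊆ E) (hδr : δ ^ 2 < r / 2)
    (c : ι → Fin n → ℝ) (ω : ι → Bool) :
    prune (E ∩ paraboloid p) (fun i => cap p δ (c i)) ω ∈ ConvexClass E := by
  rw [prune_cap_eq]
  refine ⟨Set.inter_subset_left.trans Set.inter_subset_left, ?_, ?_, ?_⟩
  · exact (hEconvex.inter (convex_paraboloid p)).inter
      (convex_iInter fun i => convex_iInter fun _ => convex_le_tangentGap p (c i) _)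
  · exact (hEcompact.isClosed.inter (isClosed_paraboloid p)).inter
      (isClosed_iInter fun i => isClosed_iInter fun _ => isClosed_le_tangentGap p (c i) _)
  -- Points more than δ² above the paraboloid lie in no cap, so an open set survives every pruning.
  · set U : Set (EuclideanSpace ℝ (Fin (n + 1))) := Metric.ball p r ∩
      {z | δ ^ 2 < z 0 - p 0 - ∑ j : Fin n, (z j.succ - p j.succ) ^ 2} with hU
    have hUo : IsOpen U := Metric.isOpen_ball.inter (isOpen_lt (by fun_prop) (by fun_prop))
    have hUn : U.Nonempty := by
      refine ⟨p + EuclideanSpace.single 0 (r / 2), ?_, ?_⟩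
      · rw [Metric.mem_ball, dist_eq_norm, add_sub_cancel_left, PiLp.norm_single,
          Real.norm_eq_abs, abs_of_pos (half_pos hr)]
        exact half_lt_self hr
      · simpa using hδr
    refine (hUo.measure_pos volume hUn).trans_le (measure_mono fun z hz => ?_)
    have hz2 : δ ^ 2 < z 0 - p 0 - ∑ j : Fin n, (z j.succ - p j.succ) ^ 2 := hz.2
    refine ⟨⟨hball hz.1, mem_paraboloid.2 (by nlinarith [sq_nonneg δ])⟩, ?_⟩
    simp only [Set.mem_iInter, Set.mem_ofPred_eq]
    intro i _
    rw [tangentGap_eq]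
    have := Finset.sum_nonneg fun (j : Fin n) (_ : j ∈ Finset.univ) =>
      sq_nonneg (z j.succ - p j.succ - c i j)
    linarith

theorem le_maxRisk_of_grid {r a δ : ℝ} (hEcompact : IsCompact E) (hEconvex : Convex ℝ E)
    (hball : Metric.ball p r ⊆ E) (hδ : 0 < δ) (hδa : δ ≤ a) (ha : a ≤ 1)
    (har : (6 * n + 3) * a < r) {m : ℕ} (hm : 2 * δ * m ≤ a) {lam : ℝ≥0}
    (hlam : lam * δ ^ (n + 2) ≤ 1) {θ : PointMeasure E → ℝ} (hθ : Measurable θ) :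
    ENNReal.ofReal (m ^ n * (((2 / (n + 1)) ^ n / 2 * δ ^ (n + 2)) ^ 2 *
      Real.exp (-2 ^ n)) / 4) ≤ maxRisk E lam θ := by
  have ha0 : 0 < a := hδ.trans_le hδa
  have hna : 0 ≤ (n : ℝ) * a := by positivity
  have hr : 0 < r := by nlinarith
  -- A grid of mⁿ abscissae with spacing 2δ; for n = 0 it consists of a single cap.
  let c : (Fin n → Fin m) → Fin n → ℝ := fun k j => 2 * δ * (k j : ℕ)
  have hc : ∀ k j, |c k j| ≤ a := by
    intro k j
    rw [abs_of_nonneg (by positivity)]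
    refine le_trans ?_ hm
    exact mul_le_mul_of_nonneg_left (by exact_mod_cast (k j).2.le) (by positivity)
  have hcE : ∀ k, cap p δ (c k) ⊆ E ∩ paraboloid p := fun k =>
    Set.subset_inter ((cap_subset_ball hδ hδa ha har (hc k)).trans hball) Set.inter_subset_left
  have hEfin : volume E ≠ ∞ := hEcompact.measure_ne_top
  have hKfin : volume (E ∩ paraboloid p) ≠ ∞ :=
    measure_ne_top_of_subset Set.inter_subset_left hEfin
  have hdisj : Pairwise fun k l => Disjoint (cap p δ (c k)) (cap p δ (c l)) := by
    intro k l hkl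
    obtain ⟨j, hj⟩ := Function.ne_iff.1 hkl
    refine disjoint_cap hδ j ?_
    have h1 : (1 : ℝ) ≤ |((k j : ℕ) : ℝ) - (l j : ℕ)| := by
      have : (1 : ℤ) ≤ |((k j : ℕ) : ℤ) - (l j : ℕ)| :=
        Int.one_le_abs (sub_ne_zero.2 fun h => hj (Fin.ext (by exact_mod_cast h)))
      exact_mod_cast this
    simp only [c]
    rw [← mul_sub, abs_mul, abs_of_pos (by positivity : 0 < 2 * δ)]
    exact le_mul_of_one_le_right (by positivity) h1
  have hlow : ∀ k, (2 / (n + 1)) ^ n / 2 * δ ^ (n + 2) ≤ volume.real (cap p δ (c k)) := fun k =>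
    (ENNReal.ofReal_le_iff_le_toReal (measure_ne_top_of_subset (hcE k) hKfin)).1
      (le_volume_cap p hδ (c k))
  have hup : ∀ k, volume.real (cap p δ (c k)) ≤ 2 ^ n * δ ^ (n + 2) := fun k =>
    ENNReal.toReal_le_of_le_ofReal (by positivity) (volume_cap_le p hδ (c k))
  have hmain := le_maxRisk_of_prune
    (isPoissonPointProcess_poissonLaw hEcompact.measurableSet lam hEfin) Set.inter_subset_left
    (hEcompact.measurableSet.inter (isClosed_paraboloid p).measurableSet) hKfin
    (fun k => measurableSet_cap p δ (c k)) hcE hdisj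
    (prune_cap_mem_convexClass hEcompact hEconvex hr hball (by nlinarith) c) hθ
  refine le_trans (ENNReal.ofReal_le_ofReal ?_) hmain
  gcongr
  have hcard : (m : ℝ) ^ n = (Finset.univ : Finset (Fin n → Fin m)).card := by simp
  rw [hcard, ← nsmul_eq_mul]
  refine Finset.card_nsmul_le_sum _ _ _ fun k _ => ?_
  have hexp : (lam : ℝ) * volume.real (cap p δ (c k)) ≤ 2 ^ n :=
    calc (lam : ℝ) * volume.real (cap p δ (c k)) ≤ lam * (2 ^ n * δ ^ (n + 2)) := by
          gcongr; exact hup k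
      _ = 2 ^ n * (lam * δ ^ (n + 2)) := by ring
      _ ≤ 2 ^ n := mul_le_of_le_one_right (by positivity) hlam
  gcongr
  exact hlow k

/-- The lower bound `c * δ ^ (d + 3)` for the maximal risk when `lam * δ ^ (d + 1) ≤ 1`. -/
theorem exists_le_maxRisk (hEcompact : IsCompact E) (hEconvex : Convex ℝ E)
    (hEint : (interior E).Nonempty) :
    ∃ c : ℝ, 0 < c ∧ ∃ δ₀ : ℝ, 0 < δ₀ ∧ ∀ δ : ℝ, 0 < δ → δ ≤ δ₀ → ∀ lam : ℝ≥0,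
      lam * δ ^ (n + 2) ≤ 1 → ∀ θ : PointMeasure E → ℝ, Measurable θ →
        ENNReal.ofReal (c * δ ^ (n + 4)) ≤ maxRisk E lam θ := by
  obtain ⟨p, hp⟩ := hEint
  obtain ⟨r, hr, hball⟩ := Metric.isOpen_iff.1 isOpen_interior p hp
  have hball' : Metric.ball p r ⊆ E := hball.trans interior_subset
  obtain ⟨a, ha0, ha⟩ : ∃ a : ℝ, 0 < a ∧ a ≤ 1 ∧ (6 * n + 3) * a < r := by
    refine ⟨min 1 (r / (6 * n + 4)), by positivity, min_le_left _ _, ?_⟩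
    calc (6 * n + 3 : ℝ) * min 1 (r / (6 * n + 4)) ≤ (6 * n + 3) * (r / (6 * n + 4)) := by
          gcongr; exact min_le_right _ _
      _ < (6 * n + 4) * (r / (6 * n + 4)) := by gcongr; norm_num
      _ = r := by field_simp
  -- The factor (a/4)ⁿ comes from having at least a/(4δ) grid points per axis. The bound δ ≤ a/2
  -- makes a/(2δ) ≥ 1, so rounding down loses at most a factor 2.
  refine ⟨(a / 4) ^ n * (((2 / (n + 1)) ^ n / 2) ^ 2 * Real.exp (-2 ^ n)) / 4, by positivity,
    a / 2, by positivity, fun δ hδ hδa lam hlam θ hθ => ?_⟩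
  have hx : 1 ≤ a / (2 * δ) := by
    rw [one_le_div (by positivity)]
    linarith
  have hm : 2 * δ * (⌊a / (2 * δ)⌋₊ : ℕ) ≤ a := by
    have := Nat.floor_le (zero_le_one.trans hx)
    rw [le_div_iff₀ (by positivity)] at this
    linarith
  have hm2 : a / (4 * δ) ≤ (⌊a / (2 * δ)⌋₊ : ℕ) := by
    have h1 := Nat.lt_floor_add_one (a / (2 * δ))
    have h2 : (1 : ℝ) ≤ (⌊a / (2 * δ)⌋₊ : ℕ) := by exact_mod_cast Nat.one_le_floor_iff _ |>.2 hx
    have h3 : a / (4 * δ) = a / (2 * δ) / 2 := by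
      rw [div_div]; congr 1; ring
    rw [h3]
    linarith
  refine le_trans (ENNReal.ofReal_le_ofReal ?_)
    (le_maxRisk_of_grid hEcompact hEconvex hball' hδ (by linarith) ha.1 ha.2 hm hlam hθ)
  calc (a / 4) ^ n * (((2 / (n + 1)) ^ n / 2) ^ 2 * Real.exp (-2 ^ n)) / 4 * δ ^ (n + 4)
      = (a / (4 * δ)) ^ n * (((2 / (n + 1)) ^ n / 2 * δ ^ (n + 2)) ^ 2 *
          Real.exp (-2 ^ n)) / 4 := by
        have : (a / 4) ^ n = (a / (4 * δ)) ^ n * δ ^ n := by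
          rw [← mul_pow]; congr 1; field_simp
        rw [this]
        ring
    _ ≤ _ := by gcongr

end LowerBound

end ConvexSupport

end

theorem mainTheorem7 (d : ℕ) (hd : 1 ≤ d) (E : Set (EuclideanSpace ℝ (Fin d)))
    (hEcompact : IsCompact E) (hEconvex : Convex ℝ E) (hEint : (interior E).Nonempty) :
    0 < Filter.liminf
      (fun lam : ℝ≥0 =>
        ((lam ^ (((d : ℝ) + 3) / ((d : ℝ) + 1)) : ℝ≥0) : ℝ≥0∞) *
          ConvexSupport.minimaxRisk E lam)
      Filter.atTop := by
  obtain ⟨n, rfl⟩ : ∃ n, d = n + 1 := ⟨d - 1, by omega⟩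
  obtain ⟨c, hc, δ₀, hδ₀, h⟩ := ConvexSupport.exists_le_maxRisk hEcompact hEconvex hEint
  refine (ENNReal.ofReal_pos.2 hc).trans_le (Filter.le_liminf_of_le (by isBoundedDefault) ?_)
  have hlim : Filter.Tendsto (fun lam : ℝ≥0 => (lam : ℝ) ^ (-(1 / ((n : ℝ) + 2))))
      Filter.atTop (nhds 0) :=
    (tendsto_rpow_neg_atTop (by positivity)).comp (NNReal.tendsto_coe_atTop.2 Filter.tendsto_id)
  filter_upwards [Filter.eventually_gt_atTop 0, hlim.eventually_le_const hδ₀] with lam hlam hle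
  have hlam' : (0 : ℝ) < lam := hlam
  -- The scale at which lam · δ^(d+1) = 1; the normalising power of `lam` then cancels δ^(d+3)
  -- exactly and leaves `c`.
  set δ : ℝ := (lam : ℝ) ^ (-(1 / ((n : ℝ) + 2))) with hδ
  have hδpos : 0 < δ := Real.rpow_pos_of_pos hlam' _
  have hpow : ∀ k : ℕ, δ ^ k = (lam : ℝ) ^ (-((k : ℝ) / ((n : ℝ) + 2))) := by
    intro k
    rw [hδ, ← Real.rpow_natCast, ← Real.rpow_mul hlam'.le]
    congr 1
    ring
  have h1 : (lam : ℝ) * δ ^ (n + 2) ≤ 1 := by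
    rw [hpow]
    push_cast
    rw [div_self (by positivity), Real.rpow_neg_one, mul_inv_cancel₀ hlam'.ne']
  have hrisk : ENNReal.ofReal (c * δ ^ (n + 4)) ≤ ConvexSupport.minimaxRisk E lam :=
    le_iInf fun θ => le_iInf fun hθ => h δ hδpos hle lam h1 θ hθ
  refine le_trans (le_of_eq ?_) (mul_le_mul_right hrisk _)
  rw [← ENNReal.ofReal_coe_nnreal, NNReal.coe_rpow, ← ENNReal.ofReal_mul (by positivity), hpow]
  congr 1
  have : ((n + 4 : ℕ) : ℝ) / (n + 2) = (((n + 1 : ℕ) : ℝ) + 3) / (((n + 1 : ℕ) : ℝ) + 1) := by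
    push_cast
    congr 1 <;> ring
  rw [this, mul_left_comm, ← Real.rpow_add hlam', add_neg_cancel, Real.rpow_zero, mul_one]
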